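/- Let $0\le\alpha<1$ and let $m,N\ge 1$ be integers. Let $\mathcal S^*(\alpha)$ be the class of starlike functions of order $\alpha$: analytic functions $f(z)=z+\sum_{n\ge2}a_nz^n$ on the unit disk $\mathbb D=\{|z|<1\}$ with $\operatorname{Re}\bigl(zf'(z)/f(z)\bigr)>\alpha$ on $\mathbb D$; put $a_1=1$ and $\Omega=f(\mathbb D)$, and let $d(0,\partial\Omega)$ be the Euclidean distance from $0$ to the boundary of $\Omega$. Then the equation $$\frac{r^m}{(1-r^m)^{2(1-\alpha)}}+A(r)+\sum_{n=\max\{N,2\}}^{\infty}\ \prod_{k=0}^{n-2}\frac{k+2(1-\alpha)}{k+1}\,r^n-\frac1{4^{1-\alpha}}=0,\qquad A(r)=\begin{cases}r,&N=1,\\0,&N\ge2,\end{cases}$$ has a smallest root $r_0$ in $(0,1)$, and for every $f\in\mathcal S^*(\alpha)$ $$|f(z^m)|+\sum_{n=N}^{\infty}|a_n||z|^n\le d(0,\partial\Omega)\qquad\text{whenever } |z|\le r_0 .$$ The radius $r_0$ is sharp: there is an $f\in\mathcal S^*(\alpha)$ for which equality holds at some $z$ with $|z|=r_0$, and for which, for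 every $r\in(r_0,1)$, the inequality fails at some $z$ with $|z|=r$. -/

import Mathlib

open Metric Set

noncomputable section

/-- The class `𝒮*(α)`: functions `f` analytic in the open unit disk, normalized by `f 0 = 0` and
`f' 0 = 1`, with `Re (z f'(z) / f(z)) > α` in the disk. At `z = 0` the quotient has a removable
singularity with value `1`, so the condition is imposed off the origin, where it presupposes
`f z ≠ 0`. -/
structure IsStarlikeOfOrder (α : ℝ) (f : ℂ → ℂ) : Prop where
  differentiableOn : DifferentiableOn ℂ f (ball 0 1)
  map_zero : f 0 = 0
  deriv_zero : deriv f 0 = 1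
  ne_zero : ∀ z ∈ ball (0 : ℂ) 1, z ≠ 0 → f z ≠ 0
  lt_re : ∀ z ∈ ball (0 : ℂ) 1, z ≠ 0 → α < (z * deriv f z / f z).re

/-- The `n`-th Taylor coefficient of `f` at the origin. -/
def taylorCoeff (f : ℂ → ℂ) (n : ℕ) : ℂ :=
  iteratedDeriv n f 0 / (n.factorial : ℂ)

/-- The Bohr–Rogosinski sum `|f(z^m)| + ∑_{n ≥ N} |a_n| |z|^n`. -/
def bohrRogosinskiSum (f : ℂ → ℂ) (m N : ℕ) (z : ℂ) : ℝ :=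
  ‖f (z ^ m)‖ + ∑' j : ℕ, ‖taylorCoeff f (N + j)‖ * ‖z‖ ^ (N + j)

/-- The Euclidean distance from `0` to the boundary of `Ω = f(𝔻)`. -/
def distToBoundary (f : ℂ → ℂ) : ℝ :=
  infDist 0 (frontier (f '' ball (0 : ℂ) 1))

/-- `∏_{k=0}^{n-2} (k + 2(1-α)) / (k+1)`, used for `n ≥ 2`. -/
def starlikeCoeffBound (α : ℝ) (n : ℕ) : ℝ :=
  ∏ k ∈ Finset.range (n - 1), ((k : ℝ) + 2 * (1 - α)) / ((k : ℝ) + 1)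

/-- The left-hand side of the equation for the radius, for `0 < r < 1`. The term of index `n = 1`
(present only for `N = 1`) is `A(r) = r`; the product formula is used for the indices `n ≥ 2`,
so the series runs over `n ≥ max N 2`. -/
def radiusEquation (α : ℝ) (m N : ℕ) (r : ℝ) : ℝ :=
  r ^ m / (1 - r ^ m) ^ (2 * (1 - α))
    + (if N = 1 then r else 0)
    + ∑' j : ℕ, starlikeCoeffBound α (max N 2 + j) * r ^ (max N 2 + j)
    - 1 / (4 : ℝ) ^ (1 - α)

end

/-! ### Algebra of Taylor coefficients at the origin. -/

section TaylorCoeff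

open Filter Topology

/-! Both sides of the inequality are extremal for the same function, the generalized Koebe function
`z / (1 - z) ^ (2 (1 - α))`. Writing `f z = z * exp (g z)` turns starlikeness into a half-plane
condition on `1 + z g'(z)`. Carathéodory's inequality bounds the coefficients of `g'`, and the
recursion from `φ' = g' φ` with `φ = exp g` passes this to `|a_n|`
(`IsStarlikeOfOrder.norm_taylorCoeff_le`); summing gives the upper growth bound for `|f(z^m)|`. So
the left side is at most a majorant depending on `|z|` alone.

Harnack's inequality, integrated along rays, gives the lower growth bound. Since `f` is univalent,
boundary points of `Ω` are limits of values taken along `|z| → 1`, hence the distance is at least `4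
^ (-(1 - α))` (`IsStarlikeOfOrder.le_distToBoundary`).

The majorant is continuous and strictly increasing, so it meets this constant exactly once, at `r₀`.
The extremal function equals its majorant on the positive radius and attains the distance at `-1`,
which gives sharpness. -/

theorem taylorCoeff_mul {f g : ℂ → ℂ} (hf : AnalyticAt ℂ f 0) (hg : AnalyticAt ℂ g 0) (n : ℕ) :
    taylorCoeff (fun z => f z * g z) n =
      ∑ i ∈ Finset.range (n + 1), taylorCoeff f i * taylorCoeff g (n - i) := by
  have hL := iteratedDeriv_mul (n := n) (hf.contDiffAt (n := n)) (hg.contDiffAt (n := n))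
  have hL' : iteratedDeriv n (fun z => f z * g z) 0 = _ := hL
  rw [taylorCoeff, hL', Finset.sum_div]
  refine Finset.sum_congr rfl fun i hi => ?_
  have hin : i ≤ n := Nat.lt_succ_iff.mp (Finset.mem_range.mp hi)
  rw [Nat.cast_choose ℂ hin, taylorCoeff, taylorCoeff]
  have h1 : (n.factorial : ℂ) ≠ 0 := by exact_mod_cast n.factorial_ne_zero
  field_simp

theorem taylorCoeff_const_mul_add {f g : ℂ → ℂ} (hf : AnalyticAt ℂ f 0) (hg : AnalyticAt ℂ g 0)
    (c : ℂ) (n : ℕ) :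
    taylorCoeff (fun z => c * f z + g z) n = c * taylorCoeff f n + taylorCoeff g n := by
  rw [taylorCoeff, iteratedDeriv_fun_add (f := fun z => c * f z)
    (analyticAt_const.mul hf).contDiffAt hg.contDiffAt, iteratedDeriv_const_mul_field, taylorCoeff, taylorCoeff]
  ring

theorem taylorCoeff_deriv (f : ℂ → ℂ) (n : ℕ) :
    taylorCoeff (deriv f) n = (n + 1) * taylorCoeff f (n + 1) := by
  rw [taylorCoeff, taylorCoeff, iteratedDeriv_succ', Nat.factorial_succ]
  have h1 : (n.factorial : ℂ) ≠ 0 := by exact_mod_cast n.factorial_ne_zero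
  have h2 : (n : ℂ) + 1 ≠ 0 := by exact_mod_cast n.succ_ne_zero
  push_cast
  field_simp

theorem taylorCoeff_congr {f g : ℂ → ℂ} (h : f =ᶠ[𝓝 0] g) (n : ℕ) :
    taylorCoeff f n = taylorCoeff g n := by
  rw [taylorCoeff, taylorCoeff, (h.iteratedDeriv n).eq_of_nhds]

theorem taylorCoeff_zero (f : ℂ → ℂ) : taylorCoeff f 0 = f 0 := by
  simp [taylorCoeff]

theorem taylorCoeff_id_mul_zero (f : ℂ → ℂ) : taylorCoeff (fun z => z * f z) 0 = 0 := by
  simp [taylorCoeff]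

theorem taylorCoeff_id_mul_succ {f : ℂ → ℂ} (hf : AnalyticAt ℂ f 0) (n : ℕ) :
    taylorCoeff (fun z => z * f z) (n + 1) = taylorCoeff f n := by
  rw [taylorCoeff_mul (f := fun z => z) analyticAt_id hf, Finset.sum_eq_single 1]
  · simp [taylorCoeff]
  · intro i _ hi
    have h0 : taylorCoeff (fun z => z) i = 0 := by
      rcases i with _ | _ | i
      · simp [taylorCoeff]
      · exact absurd rfl hi
      · rw [taylorCoeff, iteratedDeriv_succ', iteratedDeriv_succ']
        simp
    rw [h0, zero_mul]
  · intro h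
    simp at h

/-- A function holomorphic on the unit disk is the sum of its Taylor series there. -/
theorem hasSum_taylorCoeff {f : ℂ → ℂ} (hf : DifferentiableOn ℂ f (ball 0 1)) {z : ℂ}
    (hz : ‖z‖ < 1) : HasSum (fun n => taylorCoeff f n * z ^ n) (f z) := by
  have h := Complex.hasSum_taylorSeries_on_ball hf (z := z) (by simpa using hz)
  refine h.congr_fun fun n => ?_
  simp only [taylorCoeff, sub_zero, smul_eq_mul]
  ring

end TaylorCoeff

/-! ### Coefficient bounds from a half-plane condition. -/

section Caratheodory

open Real Filter Topology

theorem norm_circleAverage_le (f : ℂ → ℂ) (c : ℂ) (R : ℝ) :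
    ‖circleAverage f c R‖ ≤ circleAverage (fun z => ‖f z‖) c R := by
  rw [circleAverage, circleAverage, norm_smul, smul_eq_mul, Real.norm_of_nonneg (by positivity)]
  gcongr
  exact intervalIntegral.norm_integral_le_integral_norm (by positivity)

/-- The Taylor coefficients as averages over a circle. -/
theorem taylorCoeff_eq_circleAverage {q : ℂ → ℂ} (hq : DifferentiableOn ℂ q (ball 0 1)) (n : ℕ)
    {r : ℝ} (h0 : 0 < r) (h1 : r < 1) :
    taylorCoeff q n = circleAverage (fun z => q z / z ^ n) 0 r := by
  rw [circleAverage_eq_circleIntegral h0.ne']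
  have hd : DiffContOnCl ℂ q (ball 0 r) :=
    (hq.mono (closedBall_subset_ball h1)).diffContOnCl_ball subset_rfl
  have h := hd.circleIntegral_one_div_sub_center_pow_smul h0 n
  have h2 : (∮ z in C(0, r), (z - 0)⁻¹ • (q z / z ^ n)) =
      ∮ z in C(0, r), (1 / (z - 0) ^ (n + 1)) • q z := by
    refine circleIntegral.integral_congr h0.le fun z hz => ?_
    have hz0 : z ≠ 0 := by
      rintro rfl
      simp at hz
      exact h0.ne hz
    simp only [sub_zero, smul_eq_mul]
    field_simp
    ring
  rw [h2, h, taylorCoeff, smul_eq_mul, smul_eq_mul]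
  have hpi : (2 * π * Complex.I : ℂ) ≠ 0 := Complex.two_pi_I_ne_zero
  field_simp

/-- Carathéodory's coefficient inequality: if `1 + z q(z)` has real part larger than `α`, then the
coefficients of `q` are bounded by `2 (1 - α)`. -/
theorem norm_taylorCoeff_le_of_lt_re {α : ℝ} {q : ℂ → ℂ} (hq : DifferentiableOn ℂ q (ball 0 1))
    (hre : ∀ z ∈ ball (0 : ℂ) 1, α < (1 + z * q z).re) (n : ℕ) :
    ‖taylorCoeff q n‖ ≤ 2 * (1 - α) := by
  suffices H : ∀ r ∈ Ioo (0 : ℝ) 1, ‖taylorCoeff q n‖ * r ^ (n + 1) ≤ 2 * (1 - α) by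
    have ht : Tendsto (fun r : ℝ => ‖taylorCoeff q n‖ * r ^ (n + 1)) (𝓝[<] 1)
        (𝓝 (‖taylorCoeff q n‖ * 1 ^ (n + 1))) :=
      ((by fun_prop : Continuous fun r : ℝ => ‖taylorCoeff q n‖ * r ^ (n + 1)).tendsto
        1).mono_left nhdsWithin_le_nhds
    rw [one_pow, mul_one] at ht
    exact le_of_tendsto ht (mem_of_superset (Ioo_mem_nhdsLT one_pos) H)
  rintro r ⟨h0, h1⟩
  have hsub : closedBall (0 : ℂ) r ⊆ ball 0 1 := closedBall_subset_ball h1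
  have hsph : sphere (0 : ℂ) |r| ⊆ ball 0 1 := by
    rw [abs_of_pos h0]; exact sphere_subset_closedBall.trans hsub
  set u : ℂ → ℂ := fun z => z * q z + (1 - α) with hu
  have hud : DifferentiableOn ℂ u (ball 0 1) := by fun_prop
  have hcl : ∀ {g : ℂ → ℂ}, DifferentiableOn ℂ g (ball 0 1) → DiffContOnCl ℂ g (ball 0 |r|) := by
    intro g hg
    rw [abs_of_pos h0]
    exact (hg.mono hsub).diffContOnCl_ball subset_rfl
  have hupos : ∀ z ∈ ball (0 : ℂ) 1, 0 < (u z).re := by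
    intro z hz
    have := hre z hz
    simp [hu] at this ⊢
    linarith
  -- The average of the conjugate of `z ^ (n + 1) * (u z + (1 - α))` vanishes.
  have hF : circleAverage (fun z => (starRingEnd ℂ) (z ^ (n + 1) * (u z + (1 - α)))) 0 r = 0 := by
    have hFd : DifferentiableOn ℂ (fun z => z ^ (n + 1) * (u z + (1 - α))) (ball 0 1) := by
      fun_prop
    have hA := (hcl hFd).circleAverage
    have hci : CircleIntegrable (fun z => z ^ (n + 1) * (u z + (1 - α))) 0 r :=
      (hFd.continuousOn.mono hsph).circleIntegrable'
    have := Complex.conjCLE.toContinuousLinearMap.circleAverage_comp_comm hci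
    have h3 : circleAverage (fun z => (starRingEnd ℂ) (z ^ (n + 1) * (u z + (1 - α)))) 0 r =
      (starRingEnd ℂ) (circleAverage (fun z => z ^ (n + 1) * (u z + (1 - α))) 0 r) := by
      exact this
    rw [h3, hA]
    simp
  have hne : ∀ z ∈ sphere (0 : ℂ) |r|, z ≠ 0 := by
    rintro z hz rfl
    rw [abs_of_pos h0] at hz
    simp at hz
    exact h0.ne hz
  have hqc : ContinuousOn (fun z => q z / z ^ n) (sphere (0 : ℂ) |r|) :=
    (hq.continuousOn.mono hsph).div (by fun_prop) fun z hz => pow_ne_zero _ (hne z hz)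
  have hconj : ∀ z ∈ sphere (0 : ℂ) |r|,
      (starRingEnd ℂ) z = r ^ 2 / z := by
    intro z hz
    rw [eq_div_iff (hne z hz), mul_comm, Complex.mul_conj, Complex.normSq_eq_norm_sq]
    rw [abs_of_pos h0] at hz
    simp only [mem_sphere_iff_norm, sub_zero] at hz
    rw [hz]; push_cast; rfl
  -- On `|z| = r`, `conj z = r² / z` and `2 Re u = u + conj u`, so `r ^ (2 (n + 1))` times the
  -- difference of the two integrands is the conjugate function whose average was shown to vanish.
  have hkey : taylorCoeff q n =
      circleAverage (fun z => ((2 * (u z).re : ℝ) : ℂ) / z ^ (n + 1)) 0 r := by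
    have hr2 : ((r : ℂ) ^ 2) ^ (n + 1) ≠ 0 := by
      exact pow_ne_zero _ (pow_ne_zero _ (by exact_mod_cast h0.ne'))
    have hF' : circleAverage (fun z => ((r : ℂ) ^ 2) ^ (n + 1) •
        (((2 * (u z).re : ℝ) : ℂ) / z ^ (n + 1) - q z / z ^ n)) 0 r = 0 := by
      refine Eq.trans ?_ hF
      refine circleAverage_congr_sphere fun z hz => ?_
      have hz0 := hne z hz
      simp only [map_mul, map_pow, map_add, map_sub, map_one, Complex.conj_ofReal, hconj z hz,
        smul_eq_mul]
      have h4 : (starRingEnd ℂ) (u z) = ((2 * (u z).re : ℝ) : ℂ) - u z := by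
        rw [← Complex.add_conj]; ring
      rw [h4, div_pow]
      generalize ((2 * (u z).re : ℝ) : ℂ) = t
      simp only [hu]
      field_simp
      ring
    rw [circleAverage_fun_smul, smul_eq_zero, or_iff_right hr2, circleAverage_fun_sub, sub_eq_zero]
      at hF'
    · rw [hF', taylorCoeff_eq_circleAverage hq n h0 h1]
    · refine ContinuousOn.circleIntegrable' (ContinuousOn.div ?_ (by fun_prop)
        fun z hz => pow_ne_zero _ (hne z hz))
      have := hud.continuousOn.mono hsph
      fun_prop
    · exact hqc.circleIntegrable'
  -- Positivity of `Re u` lets its mean value `u 0 = 1 - α` control the average of the modulus.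
  have havg : circleAverage (fun z => (u z).re) 0 r = 1 - α := by
    have hci : CircleIntegrable u 0 r := (hud.continuousOn.mono hsph).circleIntegrable'
    have h5 : circleAverage (fun z => (u z).re) 0 r = (circleAverage u 0 r).re :=
      Complex.reCLM.circleAverage_comp_comm hci
    rw [h5, (hcl hud).circleAverage]
    simp [hu]
  have hle := norm_circleAverage_le (fun z => ((2 * (u z).re : ℝ) : ℂ) / z ^ (n + 1)) 0 r
  have heq : circleAverage (fun z => ‖((2 * (u z).re : ℝ) : ℂ) / z ^ (n + 1)‖) 0 r =
      circleAverage (fun z => (2 / r ^ (n + 1)) • (u z).re) 0 r := by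
    refine circleAverage_congr_sphere fun z hz => ?_
    have hz' : ‖z‖ = r := by
      rw [abs_of_pos h0] at hz; simpa using hz
    simp only [norm_div, norm_pow, hz', Complex.norm_real, smul_eq_mul]
    rw [Real.norm_of_nonneg (by linarith [hupos z (hsph hz)])]
    ring
  rw [heq, circleAverage_fun_smul, havg, ← hkey, smul_eq_mul] at hle
  have hrn : 0 < r ^ (n + 1) := by positivity
  calc ‖taylorCoeff q n‖ * r ^ (n + 1) ≤ 2 / r ^ (n + 1) * (1 - α) * r ^ (n + 1) := by gcongr
    _ = 2 * (1 - α) := by field_simp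

end Caratheodory

/-! ### Exponential representation of starlike functions. -/

section Representation

open Filter Topology

/-- A starlike function of order `α` is `z ↦ z * exp (g z)` with `1 + z g'(z)` of real part larger
than `α`. -/
theorem IsStarlikeOfOrder.exists_eq_mul_exp {α : ℝ} {f : ℂ → ℂ} (hf : IsStarlikeOfOrder α f)
    (hα : α < 1) :
    ∃ g : ℂ → ℂ, DifferentiableOn ℂ g (ball 0 1) ∧ g 0 = 0 ∧
      (∀ z ∈ ball (0 : ℂ) 1, f z = z * Complex.exp (g z)) ∧
      ∀ z ∈ ball (0 : ℂ) 1, α < (1 + z * deriv g z).re := by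
  set φ := dslope f 0 with hφ
  have h01 : (0 : ℂ) ∈ ball (0 : ℂ) 1 := by simp
  have hφd : DifferentiableOn ℂ φ (ball 0 1) :=
    (Complex.differentiableOn_dslope (isOpen_ball.mem_nhds h01)).2 hf.differentiableOn
  have hfφ : ∀ z, f z = z * φ z := by
    intro z
    have := sub_smul_dslope f 0 z
    simp only [sub_zero, smul_eq_mul, hf.map_zero] at this
    exact this.symm
  have hφ0 : φ 0 = 1 := by rw [hφ, dslope_same, hf.deriv_zero]
  have hφne : ∀ z ∈ ball (0 : ℂ) 1, φ z ≠ 0 := by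
    intro z hz
    by_cases h : z = 0
    · rw [h, hφ0]; exact one_ne_zero
    · intro h'
      apply hf.ne_zero z hz h
      rw [hfφ, h', mul_zero]
  -- `φ` is `f z / z` with the singularity removed; being zero-free on a disk it has a logarithm,
  -- the primitive of `φ' / φ`.
  have hqd : DifferentiableOn ℂ (fun z => deriv φ z / φ z) (ball 0 1) :=
    (hφd.deriv isOpen_ball).div hφd hφne
  obtain ⟨g, hg0, hg⟩ := hqd.isExactOn_ball.with_val_at 0 0
  have hφat : ∀ z ∈ ball (0 : ℂ) 1, HasDerivAt φ (deriv φ z) z := fun z hz =>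
    (hφd.differentiableAt (isOpen_ball.mem_nhds hz)).hasDerivAt
  have hφg : ∀ z ∈ ball (0 : ℂ) 1, φ z = Complex.exp (g z) := by
    have hH : ∀ z ∈ ball (0 : ℂ) 1, HasDerivAt (fun z => φ z * Complex.exp (-g z)) 0 z := by
      intro z hz
      convert! (hφat z hz).mul (hg z hz).neg.cexp using 1
      have := hφne z hz
      simp only [Pi.neg_apply]
      field_simp
      ring
    intro z hz
    have hc := (convex_ball (0 : ℂ) 1).is_const_of_fderivWithin_eq_zero (𝕜 := ℂ)
      (f := fun z => φ z * Complex.exp (-g z))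
      (fun z hz => (hH z hz).differentiableAt.differentiableWithinAt)
      (fun z hz => by
        rw [fderivWithin_of_isOpen isOpen_ball hz]
        ext
        simpa using (hH z hz).deriv) hz h01
    simp only [hg0, hφ0, neg_zero, Complex.exp_zero, mul_one, Complex.exp_neg] at hc
    field_simp at hc
    exact hc
  have hgd : DifferentiableOn ℂ g (ball 0 1) := fun z hz =>
    (hg z hz).differentiableAt.differentiableWithinAt
  refine ⟨g, hgd, hg0, fun z hz => by rw [hfφ, hφg z hz], fun z hz => ?_⟩
  by_cases h : z = 0
  · simpa [h] using hα
  · have h1 := hf.lt_re z hz h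
    have hd : deriv f z = φ z + z * deriv φ z := by
      have : f = fun z => z * φ z := funext hfφ
      rw [this]
      simpa using! ((hasDerivAt_id z).mul (hφat z hz)).deriv
    rw [hd, hfφ] at h1
    rw [(hg z hz).deriv]
    convert h1 using 2
    have := hφne z hz
    field_simp

end Representation

/-! ### Harnack's inequality and the lower growth bound. -/

section Growth

open Filter Topology

/-- Harnack's lower bound for `z q(z)` when its real part is larger than `-c`. -/
theorem neg_le_re_of_neg_lt_re {c : ℝ} (hc : 0 < c) {v : ℂ → ℂ}
    (hv : DifferentiableOn ℂ v (ball 0 1)) (hv0 : v 0 = 0)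
    (hre : ∀ z ∈ ball (0 : ℂ) 1, -c < (v z).re) {z : ℂ} (hz : z ∈ ball (0 : ℂ) 1) :
    -(2 * c * ‖z‖ / (1 + ‖z‖)) ≤ (v z).re := by
  -- The map `w ↦ w / (2c + w)` sends the half-plane `Re w > -c` into the unit disk and fixes `0`,
  -- so Schwarz's lemma applies.
  have hne : ∀ z ∈ ball (0 : ℂ) 1, 2 * c + v z ≠ 0 := by
    intro z hz h
    have h1 := hre z hz
    have h2 := congrArg Complex.re h
    simp at h2
    linarith
  have hwd : DifferentiableOn ℂ (fun z => v z / (2 * c + v z)) (ball 0 1) :=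
    hv.div (hv.const_add _) hne
  have hlt : ∀ z ∈ ball (0 : ℂ) 1, ‖v z‖ < ‖2 * c + v z‖ := by
    intro z hz
    have h1 := hre z hz
    refine lt_of_pow_lt_pow_left₀ 2 (norm_nonneg _) ?_
    rw [← Complex.normSq_eq_norm_sq, ← Complex.normSq_eq_norm_sq, Complex.normSq_apply,
      Complex.normSq_apply]
    simp
    nlinarith
  have hmaps : MapsTo (fun z => v z / (2 * c + v z)) (ball 0 1) (ball 0 1) := by
    intro z hz
    simp only [mem_ball_zero_iff, norm_div]
    rw [div_lt_one (norm_pos_iff.2 (hne z hz))]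
    exact hlt z hz
  have hz1 : ‖z‖ < 1 := by simpa using hz
  have hS := Complex.norm_le_norm_of_mapsTo_ball hwd (hmaps.mono_right ball_subset_closedBall)
    (by simp [hv0]) hz1
  rw [norm_div, div_le_iff₀ (norm_pos_iff.2 (hne z hz))] at hS
  have hr := norm_nonneg z
  set r := ‖z‖
  have hsq : ‖v z‖ ^ 2 ≤ r ^ 2 * ‖2 * c + v z‖ ^ 2 := by
    rw [← mul_pow]; gcongr
  rw [← Complex.normSq_eq_norm_sq (v z), ← Complex.normSq_eq_norm_sq (2 * c + v z),
    Complex.normSq_apply, Complex.normSq_apply] at hsq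
  simp only [Complex.add_re, Complex.add_im, Complex.mul_re, Complex.mul_im, Complex.re_ofNat,
    Complex.im_ofNat, Complex.ofReal_re, Complex.ofReal_im, mul_zero, zero_mul, sub_zero,
    zero_add] at hsq
  set x := (v z).re
  set y := (v z).im
  -- Schwarz's inequality squared reads `(x(1+r) + 2cr)(x(1-r) - 2cr) + (1-r²)y² ≤ 0`; if the claim
  -- fails, both factors are negative.
  by_contra hcon
  rw [not_le, neg_eq_neg_one_mul, ← mul_div_assoc, lt_div_iff₀ (by linarith)] at hcon
  have hx : x < 0 := by
    by_contra hx
    nlinarith [mul_nonneg hc.le hr, mul_nonneg (not_lt.1 hx) (by linarith : (0:ℝ) ≤ 1 + r)]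
  have h2 : x * (1 - r) - 2 * c * r < 0 := by
    nlinarith [mul_nonneg hc.le hr, mul_neg_of_neg_of_pos hx (by linarith : (0:ℝ) < 1 - r)]
  have h3 : 0 < (x * (1 + r) + 2 * c * r) * (x * (1 - r) - 2 * c * r) :=
    mul_pos_of_neg_of_neg (by linarith) h2
  have h4 : 0 ≤ (1 - r ^ 2) * y ^ 2 := mul_nonneg (by nlinarith) (sq_nonneg y)
  nlinarith

/-- If `1 + z g'(z)` has real part larger than `α` and `g 0 = 0`, then `exp (g z)` is at least
`(1 + |z|) ^ (-2 (1 - α))` in modulus. -/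
theorem neg_mul_log_le_re {α : ℝ} (hα : α < 1) {g : ℂ → ℂ}
    (hg : DifferentiableOn ℂ g (ball 0 1)) (hg0 : g 0 = 0)
    (hre : ∀ z ∈ ball (0 : ℂ) 1, α < (1 + z * deriv g z).re) {z : ℂ} (hz : z ∈ ball (0 : ℂ) 1) :
    -(2 * (1 - α) * Real.log (1 + ‖z‖)) ≤ (g z).re := by
  have hz1 : ‖z‖ < 1 := by simpa using hz
  have hmem : ∀ t ∈ Icc (0 : ℝ) 1, (t : ℂ) * z ∈ ball (0 : ℂ) 1 := by
    rintro t ⟨ht0, ht1⟩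
    rw [mem_ball_zero_iff, norm_mul, Complex.norm_real, Real.norm_of_nonneg ht0]
    nlinarith [norm_nonneg z]
  -- The logarithm is the primitive in `t` of Harnack's bound at `t z` divided by `t`, so the sum is
  -- nondecreasing along the ray.
  have hder : ∀ t ∈ Icc (0 : ℝ) 1, HasDerivAt
      (fun t : ℝ => (g (t * z)).re + 2 * (1 - α) * Real.log (1 + t * ‖z‖))
      ((z * deriv g (t * z)).re + 2 * (1 - α) * (‖z‖ / (1 + t * ‖z‖))) t := by
    intro t ht
    have hpos : 0 < 1 + t * ‖z‖ := by nlinarith [mul_nonneg ht.1 (norm_nonneg z)]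
    have h1 : HasDerivAt (fun t : ℝ => (t : ℂ) * z) z t := by
      simpa using (Complex.ofRealCLM.hasDerivAt (x := t)).mul_const z
    have h2 := (hg.differentiableAt (isOpen_ball.mem_nhds (hmem t ht))).hasDerivAt.scomp t h1
    have h3 : HasDerivAt (fun t : ℝ => (g (t * z)).re) (z * deriv g (t * z)).re t := by
      simpa using! Complex.reCLM.hasFDerivAt.comp_hasDerivAt t h2
    have h4 : HasDerivAt (fun t : ℝ => 1 + t * ‖z‖) ‖z‖ t := by
      simpa using ((hasDerivAt_id t).mul_const ‖z‖).const_add 1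
    exact h3.add ((h4.log hpos.ne').const_mul _)
  have hmono : MonotoneOn
      (fun t : ℝ => (g (t * z)).re + 2 * (1 - α) * Real.log (1 + t * ‖z‖)) (Icc 0 1) := by
    refine monotoneOn_of_hasDerivWithinAt_nonneg (convex_Icc 0 1)
      (fun t ht => (hder t ht).continuousAt.continuousWithinAt)
      (fun t ht => (hder t (interior_subset ht)).hasDerivWithinAt) ?_
    intro t ht
    have hti : t ∈ Icc (0 : ℝ) 1 := interior_subset ht
    rw [interior_Icc] at ht
    have hpos : 0 < 1 + t * ‖z‖ := by nlinarith [mul_nonneg hti.1 (norm_nonneg z)]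
    have hH := neg_le_re_of_neg_lt_re (c := 1 - α) (by linarith)
      (v := fun z => z * deriv g z) (differentiableOn_id.mul (hg.deriv isOpen_ball)) (by simp)
      (fun z hz => by have := hre z hz; simp at this ⊢; linarith) (hmem t hti)
    have h5 : ((t : ℂ) * z * deriv g (t * z)).re = t * (z * deriv g (t * z)).re := by
      rw [mul_assoc, Complex.re_ofReal_mul]
    simp only [h5, norm_mul, Complex.norm_real, Real.norm_of_nonneg hti.1] at hH
    refine nonneg_of_mul_nonneg_right (a := t) ?_ ht.1
    calc (0 : ℝ) ≤ t * (z * deriv g (t * z)).re + 2 * (1 - α) * (t * ‖z‖) / (1 + t * ‖z‖) := by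
          linarith
      _ = _ := by ring
  have h := hmono (left_mem_Icc.2 zero_le_one) (right_mem_Icc.2 zero_le_one) zero_le_one
  simp [hg0] at h
  linarith

/-- The lower growth estimate for starlike functions of order `α`. -/
theorem IsStarlikeOfOrder.le_norm {α : ℝ} (hα : α < 1) {f : ℂ → ℂ} (hf : IsStarlikeOfOrder α f)
    {z : ℂ} (hz : z ∈ ball (0 : ℂ) 1) : ‖z‖ / (1 + ‖z‖) ^ (2 * (1 - α)) ≤ ‖f z‖ := by
  obtain ⟨g, hg, hg0, hfg, hre⟩ := hf.exists_eq_mul_exp hα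
  rw [hfg z hz, norm_mul, Complex.norm_exp, div_eq_mul_inv,
    Real.rpow_def_of_pos (by positivity), ← Real.exp_neg]
  gcongr
  have := neg_mul_log_le_re hα hg hg0 hre hz
  linarith

end Growth

/-! ### Univalence, openness and properness of the image. -/

section Univalence

/-- A holomorphic function on a convex open set whose derivative has positive real part is
injective. -/
theorem Convex.injOn_of_deriv_re_pos {s : Set ℂ} (hs : Convex ℝ s) {h h' : ℂ → ℂ}
    (hd : ∀ z ∈ s, HasDerivAt h (h' z) z) (hre : ∀ z ∈ s, 0 < (h' z).re) : InjOn h s := by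
  intro a ha b hb hab
  by_contra hne
  have hmem : ∀ t ∈ Icc (0 : ℝ) 1, a + (t : ℂ) * (b - a) ∈ s := fun t ht => by
    simpa using hs.add_smul_sub_mem ha hb ht
  have hba : b - a ≠ 0 := sub_ne_zero.2 (Ne.symm hne)
  have hder : ∀ t ∈ Icc (0 : ℝ) 1, HasDerivAt
      (fun t : ℝ => (h (a + t * (b - a)) / (b - a)).re) (h' (a + t * (b - a))).re t := by
    intro t ht
    have h1 : HasDerivAt (fun t : ℝ => a + (t : ℂ) * (b - a)) (b - a) t := by
      simpa using ((Complex.ofRealCLM.hasDerivAt (x := t)).mul_const (b - a)).const_add a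
    have h2 := ((hd _ (hmem t ht)).scomp t h1).div_const (b - a)
    have h3 := Complex.reCLM.hasFDerivAt.comp_hasDerivAt t h2
    convert! h3 using 1
    simp [hba]
  have hmono : StrictMonoOn (fun t : ℝ => (h (a + t * (b - a)) / (b - a)).re) (Icc 0 1) := by
    refine strictMonoOn_of_hasDerivWithinAt_pos (convex_Icc 0 1)
      (fun t ht => (hder t ht).continuousAt.continuousWithinAt)
      (fun t ht => (hder t (interior_subset ht)).hasDerivWithinAt)
      fun t ht => hre _ (hmem t (interior_subset ht))
  have := hmono (left_mem_Icc.2 zero_le_one) (right_mem_Icc.2 zero_le_one) zero_lt_one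
  simp [hab] at this

/-- In the coordinate `z = exp ζ`, `f` becomes `exp (ζ + g (exp ζ))`. The exponent has derivative `1
+ z g'(z)`, of positive real part, so it is injective on the left half-plane; the `2πi` ambiguity of
the outer exponential is absorbed by shifting `ζ`. -/
theorem IsStarlikeOfOrder.injOn {α : ℝ} (hα0 : 0 ≤ α) (hα : α < 1) {f : ℂ → ℂ}
    (hf : IsStarlikeOfOrder α f) : InjOn f (ball 0 1) := by
  obtain ⟨g, hg, -, hfg, hre⟩ := hf.exists_eq_mul_exp hα
  have hexp : ∀ ζ : ℂ, ζ.re < 0 → Complex.exp ζ ∈ ball (0 : ℂ) 1 := by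
    intro ζ hζ
    rwa [mem_ball_zero_iff, Complex.norm_exp, Real.exp_lt_one_iff]
  have hinj : InjOn (fun ζ => ζ + g (Complex.exp ζ)) {ζ : ℂ | ζ.re < 0} := by
    refine (convex_halfSpace_re_lt 0).injOn_of_deriv_re_pos
      (h' := fun ζ => 1 + Complex.exp ζ * deriv g (Complex.exp ζ)) ?_
      fun ζ hζ => hα0.trans_lt (hre _ (hexp ζ hζ))
    intro ζ hζ
    have h1 := (hg.differentiableAt (isOpen_ball.mem_nhds (hexp ζ hζ))).hasDerivAt
    have h2 := (hasDerivAt_id ζ).add (h1.comp ζ (Complex.hasDerivAt_exp ζ))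
    convert! h2 using 1
    ring
  intro a ha b hb hab
  by_cases ha0 : a = 0
  · by_contra hne
    refine hf.ne_zero b hb (fun h => hne (ha0.trans h.symm)) ?_
    rw [← hab, ha0, hf.map_zero]
  by_cases hb0 : b = 0
  · exact absurd (by rw [hab, hb0, hf.map_zero]) (hf.ne_zero a ha ha0)
  have hlog : ∀ c ∈ ball (0 : ℂ) 1, c ≠ 0 → (Complex.log c).re < 0 := by
    intro c hc hc0
    rw [Complex.log_re]
    exact Real.log_neg (norm_pos_iff.2 hc0) (by simpa using hc)
  rw [hfg a ha, hfg b hb] at hab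
  have h1 : Complex.exp (Complex.log a + g a) = Complex.exp (Complex.log b + g b) := by
    rw [Complex.exp_add, Complex.exp_add, Complex.exp_log ha0, Complex.exp_log hb0, hab]
  obtain ⟨k, hk⟩ := Complex.exp_eq_exp_iff_exists_int.1 h1
  have hper : Complex.exp (Complex.log b + k * (2 * Real.pi * Complex.I)) = b := by
    rw [Complex.exp_periodic.int_mul k |> fun h => h (Complex.log b), Complex.exp_log hb0]
  have h2 := hinj (x₁ := Complex.log a) (x₂ := Complex.log b + k * (2 * Real.pi * Complex.I))
    (hlog a ha ha0) (by simpa using hlog b hb hb0)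
    (by simp only [hper, Complex.exp_log ha0]; rw [hk]; ring)
  rw [← Complex.exp_log ha0, h2, hper]

theorem IsStarlikeOfOrder.isOpen_image {α : ℝ} (hα0 : 0 ≤ α) (hα : α < 1) {f : ℂ → ℂ}
    (hf : IsStarlikeOfOrder α f) {s : Set ℂ} (hs : s ⊆ ball 0 1) (ho : IsOpen s) :
    IsOpen (f '' s) := by
  rcases (hf.differentiableOn.analyticOnNhd isOpen_ball).is_constant_or_isOpen
    (convex_ball (0 : ℂ) 1).isPreconnected with ⟨w, hw⟩ | h
  · have h0 : (0 : ℂ) ∈ ball (0 : ℂ) 1 := by simp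
    have h2 : (1 / 2 : ℂ) ∈ ball (0 : ℂ) 1 := by simp; norm_num
    have := hf.injOn hα0 hα h0 h2 ((hw _ h0).trans (hw _ h2).symm)
    norm_num at this
  · exact h s hs ho

/-- The image of the disk is not the whole plane. -/
theorem IsStarlikeOfOrder.image_ne_univ {α : ℝ} (hα0 : 0 ≤ α) (hα : α < 1) {f : ℂ → ℂ}
    (hf : IsStarlikeOfOrder α f) : f '' ball 0 1 ≠ univ := by
  intro huniv
  have hsurj : ∀ w, ∃ z ∈ ball (0 : ℂ) 1, f z = w := fun w => by
    have : w ∈ f '' ball 0 1 := huniv ▸ mem_univ w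
    exact this
  -- Otherwise the inverse of `f` would be a bounded entire function, hence constant by Liouville.
  choose k hk hfk using hsurj
  have hcont : Continuous k := by
    rw [continuous_def]
    intro U hU
    have : k ⁻¹' U = f '' (U ∩ ball 0 1) := by
      ext w
      constructor
      · intro hw
        exact ⟨k w, ⟨hw, hk w⟩, hfk w⟩
      · rintro ⟨z, ⟨hzU, hz⟩, rfl⟩
        have := hf.injOn hα0 hα (hk (f z)) hz (hfk _)
        rwa [mem_preimage, this]
    rw [this]
    exact hf.isOpen_image hα0 hα inter_subset_right (hU.inter isOpen_ball)
  have hd : Differentiable ℂ k := by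
    intro w
    have hne : deriv f (k w) ≠ 0 := by
      by_cases h : k w = 0
      · rw [h, hf.deriv_zero]; exact one_ne_zero
      · intro h0
        have := hf.lt_re _ (hk w) h
        rw [h0] at this
        simp at this
        linarith
    exact ((hf.differentiableOn.differentiableAt
      (isOpen_ball.mem_nhds (hk w))).hasDerivAt.of_local_left_inverse hcont.continuousAt hne
      (Filter.Eventually.of_forall hfk)).differentiableAt
  have hb : Bornology.IsBounded (range k) :=
    isBounded_ball.subset (range_subset_iff.2 hk)
  have := hd.apply_eq_apply_of_bounded hb 0 1
  have h01 : (0 : ℂ) = 1 := by rw [← hfk 0, this, hfk]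
  exact zero_ne_one h01

end Univalence

/-! ### Sharp coefficient bounds. -/

section Coefficients

theorem starlikeCoeffBound_one (α : ℝ) : starlikeCoeffBound α 1 = 1 := by
  simp [starlikeCoeffBound]

theorem starlikeCoeffBound_pos {α : ℝ} (hα : α < 1) (n : ℕ) : 0 < starlikeCoeffBound α n :=
  Finset.prod_pos fun k _ => div_pos (by have := k.cast_nonneg (α := ℝ); linarith)
    (by positivity)

theorem starlikeCoeffBound_add_two (α : ℝ) (n : ℕ) :
    (n + 1) * starlikeCoeffBound α (n + 2) = (n + 2 * (1 - α)) * starlikeCoeffBound α (n + 1) := by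
  have h : (n : ℝ) + 1 ≠ 0 := by positivity
  simp only [starlikeCoeffBound, Nat.add_sub_cancel, show n + 2 - 1 = n + 1 from rfl,
    Finset.prod_range_succ]
  field_simp

/-- This is the equality case of the coefficient recursion for `φ' = q φ`, with every coefficient of
`q` equal to `2 (1 - α)`. -/
theorem succ_mul_starlikeCoeffBound (α : ℝ) (n : ℕ) :
    (n + 1) * starlikeCoeffBound α (n + 2) =
      2 * (1 - α) * ∑ k ∈ Finset.range (n + 1), starlikeCoeffBound α (k + 1) := by
  induction n with
  | zero => simp [starlikeCoeffBound]
  | succ n ih =>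
    have h := starlikeCoeffBound_add_two α (n + 1)
    rw [Finset.sum_range_succ, mul_add, ← ih]
    push_cast at h ⊢
    rw [h]
    ring

/-- If `φ' = q φ`, then bounds on the coefficients of `q` propagate to those of `φ`. -/
theorem norm_taylorCoeff_le_of_deriv_eq {α : ℝ} (hα : α < 1) {φ q : ℂ → ℂ}
    (hφ : AnalyticAt ℂ φ 0) (hq : AnalyticAt ℂ q 0) (h0 : φ 0 = 1)
    (hd : deriv φ =ᶠ[nhds 0] fun z => q z * φ z)
    (hqn : ∀ n, ‖taylorCoeff q n‖ ≤ 2 * (1 - α)) (n : ℕ) :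
    ‖taylorCoeff φ n‖ ≤ starlikeCoeffBound α (n + 1) := by
  induction n using Nat.strong_induction_on with
  | _ n ih =>
    rcases n with _ | n
    · simp [taylorCoeff_zero, h0, starlikeCoeffBound_one]
    · have h1 : ((n : ℂ) + 1) * taylorCoeff φ (n + 1) =
          ∑ i ∈ Finset.range (n + 1), taylorCoeff q i * taylorCoeff φ (n - i) := by
        rw [← taylorCoeff_deriv, taylorCoeff_congr hd, taylorCoeff_mul hq hφ]
      have hn : (0 : ℝ) < n + 1 := by positivity
      refine le_of_mul_le_mul_left ?_ hn
      calc ((n : ℝ) + 1) * ‖taylorCoeff φ (n + 1)‖ = ‖((n : ℂ) + 1) * taylorCoeff φ (n + 1)‖ := by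
            rw [norm_mul]
            congr 1
            rw [← Nat.cast_add_one, ← Nat.cast_add_one, Complex.norm_natCast]
        _ ≤ ∑ i ∈ Finset.range (n + 1), 2 * (1 - α) * starlikeCoeffBound α (n - i + 1) := by
            rw [h1]
            refine norm_sum_le_of_le _ fun i hi => ?_
            rw [norm_mul]
            exact mul_le_mul (hqn i) (ih _ (by omega)) (norm_nonneg _) (by linarith)
        _ = (n + 1) * starlikeCoeffBound α (n + 2) := by
            rw [succ_mul_starlikeCoeffBound, Finset.mul_sum, ← Finset.sum_range_reflect]
            refine Finset.sum_congr rfl fun i hi => ?_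
            have : i ≤ n := Nat.lt_succ_iff.1 (Finset.mem_range.1 hi)
            congr 2
            omega

/-- The coefficient estimate for starlike functions of order `α`. -/
theorem IsStarlikeOfOrder.norm_taylorCoeff_le {α : ℝ} (hα : α < 1) {f : ℂ → ℂ}
    (hf : IsStarlikeOfOrder α f) {n : ℕ} (hn : 1 ≤ n) :
    ‖taylorCoeff f n‖ ≤ starlikeCoeffBound α n := by
  obtain ⟨g, hg, hg0, hfg, hre⟩ := hf.exists_eq_mul_exp hα
  have hnhds : ball (0 : ℂ) 1 ∈ nhds (0 : ℂ) := ball_mem_nhds 0 one_pos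
  have hga : AnalyticAt ℂ g 0 := hg.analyticAt hnhds
  have hφa : AnalyticAt ℂ (fun z => Complex.exp (g z)) 0 := hga.cexp
  obtain ⟨k, rfl⟩ : ∃ k, n = k + 1 := ⟨n - 1, by omega⟩
  rw [taylorCoeff_congr (Filter.mem_of_superset hnhds hfg : f =ᶠ[nhds 0] _),
    taylorCoeff_id_mul_succ hφa]
  refine norm_taylorCoeff_le_of_deriv_eq hα hφa hga.deriv (by simp [hg0])
    (Filter.mem_of_superset hnhds fun z hz => ?_)
    (norm_taylorCoeff_le_of_lt_re (hg.deriv isOpen_ball) hre) k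
  have := (hg.differentiableAt (isOpen_ball.mem_nhds hz)).hasDerivAt.cexp.deriv
  rw [mem_ofPred_eq, this, mul_comm]

end Coefficients

/-! ### Distance from the origin to the boundary of the image. -/

section Boundary

open Filter Topology

theorem IsStarlikeOfOrder.frontier_image {α : ℝ} (hα0 : 0 ≤ α) (hα : α < 1) {f : ℂ → ℂ}
    (hf : IsStarlikeOfOrder α f) :
    frontier (f '' ball 0 1) = closure (f '' ball 0 1) \ f '' ball 0 1 :=
  (hf.isOpen_image hα0 hα subset_rfl isOpen_ball).frontier_eq

/-- `f(𝔻)` contains the disk of radius `4 ^ (-(1 - α))` about the origin. -/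
theorem IsStarlikeOfOrder.le_distToBoundary {α : ℝ} (hα0 : 0 ≤ α) (hα : α < 1) {f : ℂ → ℂ}
    (hf : IsStarlikeOfOrder α f) : 1 / (4 : ℝ) ^ (1 - α) ≤ distToBoundary f := by
  have hne : (frontier (f '' ball (0 : ℂ) 1)).Nonempty :=
    nonempty_frontier_iff.2 ⟨⟨f 0, mem_image_of_mem f (by simp)⟩, hf.image_ne_univ hα0 hα⟩
  rw [distToBoundary, le_infDist hne]
  intro w hw
  rw [hf.frontier_image hα0 hα] at hw
  rw [dist_zero_left]
  obtain ⟨x, hx, hxw⟩ := mem_closure_iff_seq_limit.1 hw.1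
  choose z hz hzx using hx
  obtain ⟨a, ha, φ, hφ, hφa⟩ := (isCompact_closedBall (0 : ℂ) 1).tendsto_subseq
    fun n => ball_subset_closedBall (hz n)
  have hlim : Tendsto (fun n => f (z (φ n))) atTop (𝓝 w) := by
    simp only [hzx]
    exact hxw.comp hφ.tendsto_atTop
  -- A limit of preimages inside the disk would put `w` in the open image, which a frontier point
  -- avoids.
  have ha1 : ‖a‖ = 1 := by
    refine le_antisymm (by simpa using ha) (not_lt.1 fun hlt => hw.2 ?_)
    have hab : a ∈ ball (0 : ℂ) 1 := by simpa using hlt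
    have hc := (hf.differentiableOn.differentiableAt (isOpen_ball.mem_nhds hab)).continuousAt
    exact ⟨a, hab, tendsto_nhds_unique (hc.tendsto.comp hφa) hlim⟩
  have hlim2 : Tendsto (fun n => ‖z (φ n)‖ / (1 + ‖z (φ n)‖) ^ (2 * (1 - α))) atTop
      (𝓝 (‖a‖ / (1 + ‖a‖) ^ (2 * (1 - α)))) := by
    have h1 := hφa.norm
    refine h1.div ((h1.const_add 1).rpow_const (Or.inl (by positivity))) ?_
    exact (Real.rpow_pos_of_pos (by positivity) _).ne'
  have := le_of_tendsto_of_tendsto' hlim2 hlim.norm fun n => hf.le_norm hα (hz (φ n))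
  rw [ha1, Real.rpow_mul (by norm_num)] at this
  norm_num at this ⊢
  exact this

/-- Boundary values of a starlike function lie on the frontier of the image. -/
theorem IsStarlikeOfOrder.mem_frontier_of_tendsto {α : ℝ} (hα0 : 0 ≤ α) (hα : α < 1) {f : ℂ → ℂ}
    (hf : IsStarlikeOfOrder α f) {ι : Type*} {l : Filter ι} [l.NeBot] {z : ι → ℂ} {a w : ℂ}
    (hz : ∀ᶠ i in l, z i ∈ ball (0 : ℂ) 1) (ha : a ∉ ball (0 : ℂ) 1) (hza : Tendsto z l (𝓝 a))
    (hw : Tendsto (fun i => f (z i)) l (𝓝 w)) : w ∈ frontier (f '' ball 0 1) := by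
  rw [hf.frontier_image hα0 hα]
  refine ⟨mem_closure_of_tendsto hw (hz.mono fun i hi => mem_image_of_mem f hi), ?_⟩
  rintro ⟨b, hb, rfl⟩
  have hab : a ≠ b := fun h => ha (h ▸ hb)
  -- Values near `f b` have preimages near `b`, and by injectivity no others, while the `z i`
  -- approach `a`.
  obtain ⟨U, V, hU, hV, haU, hbV, hUV⟩ := t2_separation hab
  have hopen := hf.isOpen_image hα0 hα (inter_subset_right (s := V)) (hV.inter isOpen_ball)
  have h1 := hw.eventually (hopen.mem_nhds (mem_image_of_mem f ⟨hbV, hb⟩))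
  have h2 := hza.eventually (hU.mem_nhds haU)
  obtain ⟨i, hi, ⟨c, ⟨hcV, hc⟩, hci⟩, hiU⟩ := (hz.and (h1.and h2)).exists
  have := hf.injOn hα0 hα hc hi hci
  exact disjoint_left.1 hUV hiU (this ▸ hcV)

end Boundary

/-! ### The generalized Koebe function. -/

section Extremal

open Filter Topology

/-- The extremal function `z / (1 - z) ^ (2 (1 - α))`. -/
noncomputable def starlikeExtremal (α : ℝ) (z : ℂ) : ℂ :=
  z * (1 / (1 - z) ^ ((2 * (1 - α) : ℝ) : ℂ))

theorem one_sub_mem_slitPlane {z : ℂ} (hz : z ∈ ball (0 : ℂ) 1) : 1 - z ∈ Complex.slitPlane := by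
  refine Or.inl ?_
  have := (Complex.abs_re_le_norm z).trans_lt (by simpa using hz)
  simp
  exact (abs_lt.1 this).2

theorem hasDerivAt_one_div_one_sub_cpow (β : ℂ) {z : ℂ} (hz : z ∈ ball (0 : ℂ) 1) :
    HasDerivAt (fun z => 1 / (1 - z) ^ β) (β / (1 - z) * (1 / (1 - z) ^ β)) z := by
  have hs := one_sub_mem_slitPlane hz
  have h0 : 1 - z ≠ 0 := Complex.slitPlane_ne_zero hs
  have h1 : (1 - z) ^ β ≠ 0 := by simp [Complex.cpow_eq_zero_iff, h0]
  have h2 := ((hasDerivAt_id z).const_sub 1).cpow_const (c := β) hs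
  have h3 := h2.fun_inv h1
  simp only [one_div]
  convert! h3 using 1
  simp only [id]
  rw [Complex.cpow_sub _ _ h0, Complex.cpow_one]
  field_simp

theorem hasDerivAt_starlikeExtremal (α : ℝ) {z : ℂ} (hz : z ∈ ball (0 : ℂ) 1) :
    HasDerivAt (starlikeExtremal α)
      ((1 + z * (((2 * (1 - α) : ℝ) : ℂ) / (1 - z))) * (1 / (1 - z) ^ ((2 * (1 - α) : ℝ) : ℂ)))
      z := by
  convert! (hasDerivAt_id z).mul (hasDerivAt_one_div_one_sub_cpow ((2 * (1 - α) : ℝ) : ℂ) hz)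
    using 1
  simp only [id]
  ring

theorem isStarlikeOfOrder_starlikeExtremal {α : ℝ} (hα : α < 1) :
    IsStarlikeOfOrder α (starlikeExtremal α) := by
  have hne : ∀ z ∈ ball (0 : ℂ) 1, 1 / (1 - z) ^ ((2 * (1 - α) : ℝ) : ℂ) ≠ 0 := by
    intro z hz
    have h0 : 1 - z ≠ 0 := Complex.slitPlane_ne_zero (one_sub_mem_slitPlane hz)
    simp [Complex.cpow_eq_zero_iff, h0]
  refine ⟨fun z hz => (hasDerivAt_starlikeExtremal α hz).differentiableAt.differentiableWithinAt,
    by simp [starlikeExtremal], ?_, fun z hz h0 => mul_ne_zero h0 (hne z hz), ?_⟩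
  · rw [(hasDerivAt_starlikeExtremal α (by simp)).deriv]
    simp
  · intro z hz h0
    have h1 : 1 - z ≠ 0 := Complex.slitPlane_ne_zero (one_sub_mem_slitPlane hz)
    have heq : z * deriv (starlikeExtremal α) z / starlikeExtremal α z =
        α + ((1 - α : ℝ) : ℂ) * ((1 + z) / (1 - z)) := by
      rw [(hasDerivAt_starlikeExtremal α hz).deriv, starlikeExtremal]
      have := hne z hz
      generalize 1 / (1 - z) ^ ((2 * (1 - α) : ℝ) : ℂ) = t at this
      push_cast
      field_simp
      ring
    have hpos : 0 < ((1 + z) / (1 - z)).re := by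
      rw [Complex.div_re, ← add_div]
      refine div_pos ?_ (Complex.normSq_pos.2 h1)
      have hz1 : Complex.normSq z < 1 := by
        rw [Complex.normSq_eq_norm_sq]
        have : ‖z‖ < 1 := by simpa using hz
        nlinarith [norm_nonneg z]
      rw [Complex.normSq_apply] at hz1
      simp
      nlinarith
    rw [heq, Complex.add_re, Complex.ofReal_re, Complex.re_ofReal_mul]
    have := mul_pos (sub_pos.2 hα) hpos
    linarith

theorem starlikeExtremal_ofReal (α : ℝ) {r : ℝ} (hr : r < 1) :
    starlikeExtremal α r = ((r / (1 - r) ^ (2 * (1 - α)) : ℝ) : ℂ) := by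
  rw [starlikeExtremal, ← Complex.ofReal_one, ← Complex.ofReal_sub,
    ← Complex.ofReal_cpow (by linarith)]
  push_cast
  ring

theorem taylorCoeff_one_div_one_sub_cpow (α : ℝ) (n : ℕ) :
    taylorCoeff (fun z => 1 / (1 - z) ^ ((2 * (1 - α) : ℝ) : ℂ)) n =
      starlikeCoeffBound α (n + 1) := by
  set β : ℂ := ((2 * (1 - α) : ℝ) : ℂ) with hβ
  set φ : ℂ → ℂ := fun z => 1 / (1 - z) ^ β with hφ
  have hnhds : ball (0 : ℂ) 1 ∈ 𝓝 (0 : ℂ) := ball_mem_nhds 0 one_pos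
  have hφd : DifferentiableOn ℂ φ (ball 0 1) := fun z hz =>
    (hasDerivAt_one_div_one_sub_cpow β hz).differentiableAt.differentiableWithinAt
  have hφa : AnalyticAt ℂ φ 0 := hφd.analyticAt hnhds
  -- The equation `(1 - z) φ' = β φ`, rearranged so that comparing coefficients yields a two-term
  -- recursion.
  have heq : deriv φ =ᶠ[𝓝 0] fun z => β * φ z + z * deriv φ z := by
    refine mem_of_superset hnhds fun z hz => ?_
    have h0 : 1 - z ≠ 0 := Complex.slitPlane_ne_zero (one_sub_mem_slitPlane hz)
    have hd : deriv φ z = β / (1 - z) * φ z := (hasDerivAt_one_div_one_sub_cpow β hz).deriv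
    simp only [mem_ofPred_eq, hd]
    field_simp
    ring
  have hrec : ∀ k : ℕ, ((k : ℂ) + 1) * taylorCoeff φ (k + 1) = (k + β) * taylorCoeff φ k := by
    intro k
    rw [← taylorCoeff_deriv, taylorCoeff_congr heq, taylorCoeff_const_mul_add
      (g := fun z => z * deriv φ z) hφa
      (analyticAt_id.mul hφa.deriv)]
    rcases k with _ | k
    · rw [taylorCoeff_id_mul_zero]; simp
    · rw [taylorCoeff_id_mul_succ hφa.deriv, taylorCoeff_deriv]
      push_cast
      ring
  induction n with
  | zero => simp [taylorCoeff_zero, starlikeCoeffBound_one, hφ]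
  | succ n ih =>
    have h1 : (n : ℂ) + 1 ≠ 0 := by exact_mod_cast n.succ_ne_zero
    have h2 := starlikeCoeffBound_add_two α n
    apply mul_left_cancel₀ h1
    rw [hrec, ih, hβ]
    exact_mod_cast h2.symm

theorem taylorCoeff_starlikeExtremal {α : ℝ} {n : ℕ} (hn : 1 ≤ n) :
    taylorCoeff (starlikeExtremal α) n = starlikeCoeffBound α n := by
  obtain ⟨k, rfl⟩ : ∃ k, n = k + 1 := ⟨n - 1, by omega⟩
  rw [← taylorCoeff_one_div_one_sub_cpow]
  refine taylorCoeff_id_mul_succ (DifferentiableOn.analyticAt (s := ball (0 : ℂ) 1)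
    (fun z hz => ?_) (ball_mem_nhds 0 one_pos)) k
  exact (hasDerivAt_one_div_one_sub_cpow _ hz).differentiableAt.differentiableWithinAt

/-- The value approached at `-1` along the real axis is a frontier point of modulus `2 ^ (-2 (1 -
α))`, matching the general lower bound. -/
theorem distToBoundary_starlikeExtremal {α : ℝ} (hα0 : 0 ≤ α) (hα : α < 1) :
    distToBoundary (starlikeExtremal α) = 1 / (4 : ℝ) ^ (1 - α) := by
  have hf := isStarlikeOfOrder_starlikeExtremal hα
  refine le_antisymm ?_ (hf.le_distToBoundary hα0 hα)
  have hcont : Tendsto (fun r : ℝ => r / (1 - r) ^ (2 * (1 - α))) (𝓝[>] (-1))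
      (𝓝 ((-1) / (1 - (-1)) ^ (2 * (1 - α)))) := by
    refine tendsto_nhdsWithin_of_tendsto_nhds (ContinuousAt.tendsto
      (f := fun r : ℝ => r / (1 - r) ^ (2 * (1 - α))) ?_)
    refine continuousAt_id.div ((continuousAt_const.sub continuousAt_id).rpow_const
      (Or.inl (by norm_num))) (Real.rpow_pos_of_pos (by norm_num) _).ne'
  have hev : ∀ᶠ r : ℝ in 𝓝[>] (-1), r ∈ Ioo (-1 : ℝ) 1 := Ioo_mem_nhdsGT (by norm_num)
  have hmem := hf.mem_frontier_of_tendsto hα0 hα (l := 𝓝[>] (-1 : ℝ)) (z := fun r : ℝ => (r : ℂ))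
    (a := ((-1 : ℝ) : ℂ)) (w := (((-1) / (1 - (-1)) ^ (2 * (1 - α)) : ℝ) : ℂ))
    (hev.mono fun r hr => by
      rw [mem_ball_zero_iff, Complex.norm_real, Real.norm_eq_abs]; exact abs_lt.2 hr)
    (by simp) (Complex.continuous_ofReal.continuousAt.tendsto.mono_left nhdsWithin_le_nhds)
    (((Complex.continuous_ofReal.tendsto _).comp hcont).congr' (hev.mono fun r hr =>
      (starlikeExtremal_ofReal α hr.2).symm))
  refine (infDist_le_dist_of_mem hmem).trans_eq ?_
  rw [dist_zero_left, Complex.norm_real, norm_div, norm_neg, norm_one, sub_neg_eq_add,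
    Real.norm_of_nonneg (by positivity), Real.rpow_mul (by norm_num)]
  norm_num

end Extremal

/-! ### The majorant, its unique crossing and sharpness. -/

section Majorant

open Filter Topology

/-- The majorant of the Bohr–Rogosinski sums of the class `𝒮*(α)` on the circle `|z| = r`. -/
noncomputable def starlikeMajorant (α : ℝ) (m N : ℕ) (r : ℝ) : ℝ :=
  r ^ m / (1 - r ^ m) ^ (2 * (1 - α)) +
    ∑' j : ℕ, starlikeCoeffBound α (N + j) * r ^ (N + j)

theorem hasSum_starlikeCoeffBound {α : ℝ} (hα : α < 1) {r : ℝ} (h0 : 0 ≤ r) (h1 : r < 1) :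
    HasSum (fun n => starlikeCoeffBound α (n + 1) * r ^ (n + 1))
      (r / (1 - r) ^ (2 * (1 - α))) := by
  have h := hasSum_taylorCoeff (isStarlikeOfOrder_starlikeExtremal hα).differentiableOn
    (z := (r : ℂ)) (by simpa [abs_of_nonneg h0])
  rw [← hasSum_nat_add_iff' 1, starlikeExtremal_ofReal α h1] at h
  have h2 : taylorCoeff (starlikeExtremal α) 0 = 0 := by simp [taylorCoeff, starlikeExtremal]
  simp only [taylorCoeff_starlikeExtremal (Nat.le_add_left 1 _), Finset.range_one,
    Finset.sum_singleton, h2, zero_mul, sub_zero] at h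
  exact_mod_cast h

theorem hasSum_starlikeCoeffBound_add {α : ℝ} (hα : α < 1) {N : ℕ} (hN : 1 ≤ N) {r : ℝ}
    (h0 : 0 ≤ r) (h1 : r < 1) :
    HasSum (fun j => starlikeCoeffBound α (N + j) * r ^ (N + j))
      (r / (1 - r) ^ (2 * (1 - α)) -
        ∑ i ∈ Finset.range (N - 1), starlikeCoeffBound α (i + 1) * r ^ (i + 1)) := by
  have h := (hasSum_nat_add_iff' (N - 1)).2 (hasSum_starlikeCoeffBound hα h0 h1)
  refine h.congr_fun fun j => ?_
  rw [show j + (N - 1) + 1 = N + j by omega]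

/-- The separate term `A(r)` is just the index-one term: the empty product makes the coefficient
bound at `1` equal to `1`. -/
theorem radiusEquation_eq {α : ℝ} (hα : α < 1) (m : ℕ) {N : ℕ} (hN : 1 ≤ N) {r : ℝ}
    (h0 : 0 ≤ r) (h1 : r < 1) :
    radiusEquation α m N r = starlikeMajorant α m N r - 1 / (4 : ℝ) ^ (1 - α) := by
  rw [radiusEquation, starlikeMajorant]
  by_cases h : N = 1
  · subst h
    rw [(hasSum_starlikeCoeffBound_add hα le_rfl h0 h1).summable.tsum_eq_zero_add]
    simp only [if_true, starlikeCoeffBound_one, add_zero, pow_one, one_mul, max_eq_right one_le_two,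
      ← add_assoc]
    simp only [show ∀ j, 1 + j + 1 = 2 + j by omega]
  · rw [if_neg h, max_eq_left (by omega : 2 ≤ N), add_zero]

theorem strictMonoOn_div_one_sub_rpow {α : ℝ} (hα : α < 1) :
    StrictMonoOn (fun s : ℝ => s / (1 - s) ^ (2 * (1 - α))) (Ico 0 1) := by
  intro s hs t ht hst
  have h1 : (0 : ℝ) < (1 - t) ^ (2 * (1 - α)) := Real.rpow_pos_of_pos (by linarith [ht.2]) _
  refine div_lt_div₀ hst ?_ ht.1 h1
  exact Real.rpow_le_rpow (by linarith [ht.2]) (by linarith) (by linarith)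

theorem strictMonoOn_starlikeMajorant {α : ℝ} (hα : α < 1) {m N : ℕ} (hm : 1 ≤ m) (hN : 1 ≤ N) :
    StrictMonoOn (starlikeMajorant α m N) (Ico 0 1) := by
  intro s hs t ht hst
  have hm0 : m ≠ 0 := by omega
  refine add_lt_add_of_lt_of_le (strictMonoOn_div_one_sub_rpow hα
    ⟨pow_nonneg hs.1 _, pow_lt_one₀ hs.1 hs.2 hm0⟩ ⟨pow_nonneg ht.1 _, pow_lt_one₀ ht.1 ht.2 hm0⟩
    (pow_lt_pow_left₀ hst hs.1 hm0)) ?_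
  refine (hasSum_starlikeCoeffBound_add hα hN hs.1 hs.2).summable.tsum_le_tsum (fun j => ?_)
    (hasSum_starlikeCoeffBound_add hα hN ht.1 ht.2).summable
  have := (starlikeCoeffBound_pos hα (N + j)).le
  have := hs.1
  gcongr

theorem continuousOn_starlikeMajorant {α : ℝ} (hα : α < 1) {m N : ℕ} (hm : 1 ≤ m) (hN : 1 ≤ N) :
    ContinuousOn (starlikeMajorant α m N) (Ico 0 1) := by
  have hE : ContinuousOn (fun s : ℝ => s / (1 - s) ^ (2 * (1 - α))) (Ico 0 1) := by
    refine continuousOn_id.div ((continuousOn_const.sub continuousOn_id).rpow_const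
      fun s hs => Or.inl ?_) fun s hs => ?_
    · have := hs.2
      exact (by linarith : (0 : ℝ) < 1 - s).ne'
    · exact (Real.rpow_pos_of_pos (by linarith [hs.2]) _).ne'
  have hmaps : MapsTo (fun r : ℝ => r ^ m) (Ico 0 1) (Ico 0 1) := fun r hr =>
    ⟨pow_nonneg hr.1 _, pow_lt_one₀ hr.1 hr.2 (by omega)⟩
  refine ContinuousOn.add (hE.comp (by fun_prop) hmaps) ?_
  -- The closed form of the tail, a Koebe value minus a polynomial, avoids any uniform convergence
  -- argument.
  refine ContinuousOn.congr (f := fun r : ℝ => r / (1 - r) ^ (2 * (1 - α)) -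
        ∑ i ∈ Finset.range (N - 1), starlikeCoeffBound α (i + 1) * r ^ (i + 1))
    (hE.sub (by fun_prop)) fun r hr => ?_
  exact (hasSum_starlikeCoeffBound_add hα hN hr.1 hr.2).tsum_eq

theorem exists_starlikeMajorant_eq {α : ℝ} (hα : α < 1) {m N : ℕ} (hm : 1 ≤ m) (hN : 1 ≤ N) :
    ∃ r ∈ Ioo (0 : ℝ) 1, starlikeMajorant α m N r = 1 / (4 : ℝ) ^ (1 - α) := by
  have hm0 : m ≠ 0 := by omega
  set s : ℝ := 1 / (4 : ℝ) ^ (1 - α) with hs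
  have hs0 : 0 < s := by positivity
  have hs1 : s < 1 := by
    rw [hs, div_lt_one (by positivity)]
    exact Real.one_lt_rpow (by norm_num) (by linarith)
  -- Chosen so that `b ^ m = s`: the first term alone is then `s / (1 - s) ^ (2 (1 - α)) ≥ s`.
  set b : ℝ := s ^ ((m : ℝ)⁻¹) with hb
  have hbm : b ^ m = s := Real.rpow_inv_natCast_pow hs0.le hm0
  have hb0 : 0 ≤ b := Real.rpow_nonneg hs0.le _
  have hb1 : b < 1 := Real.rpow_lt_one hs0.le hs1 (by positivity)
  have hT0 : starlikeMajorant α m N 0 = 0 := by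
    have : ∀ j, starlikeCoeffBound α (N + j) * 0 ^ (N + j) = 0 := fun j => by
      rw [zero_pow (by omega), mul_zero]
    simp [starlikeMajorant, hm0, this]
  have hTb : s ≤ starlikeMajorant α m N b := by
    have h1 : 0 ≤ ∑' j : ℕ, starlikeCoeffBound α (N + j) * b ^ (N + j) :=
      tsum_nonneg fun j => mul_nonneg (starlikeCoeffBound_pos hα _).le (pow_nonneg hb0 _)
    have h2 : s ≤ s / (1 - s) ^ (2 * (1 - α)) :=
      le_div_self hs0.le (Real.rpow_pos_of_pos (by linarith) _)
        (Real.rpow_le_one (by linarith) (by linarith) (by linarith))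
    rw [starlikeMajorant, hbm]
    linarith
  obtain ⟨r, hr, hrs⟩ := intermediate_value_Icc hb0
    ((continuousOn_starlikeMajorant hα hm hN).mono
      fun r hr => ⟨hr.1, hr.2.trans_lt hb1⟩) ⟨hT0.trans_le hs0.le, hTb⟩
  refine ⟨r, ⟨lt_of_le_of_ne hr.1 ?_, hr.2.trans_lt hb1⟩, hrs⟩
  rintro rfl
  exact hs0.ne (hT0.symm.trans hrs)

theorem IsStarlikeOfOrder.norm_le {α : ℝ} (hα : α < 1) {f : ℂ → ℂ} (hf : IsStarlikeOfOrder α f)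
    {z : ℂ} (hz : ‖z‖ < 1) : ‖f z‖ ≤ ‖z‖ / (1 - ‖z‖) ^ (2 * (1 - α)) := by
  have h := hasSum_taylorCoeff hf.differentiableOn hz
  rw [← hasSum_nat_add_iff' 1] at h
  have h2 : taylorCoeff f 0 = 0 := by rw [taylorCoeff_zero, hf.map_zero]
  simp only [Finset.range_one, Finset.sum_singleton, h2, zero_mul, sub_zero] at h
  have hs := hasSum_starlikeCoeffBound hα (norm_nonneg z) hz
  rw [← h.tsum_eq]
  refine tsum_of_norm_bounded hs fun n => ?_
  rw [norm_mul, norm_pow]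
  gcongr
  exact hf.norm_taylorCoeff_le hα (Nat.le_add_left 1 n)

theorem IsStarlikeOfOrder.bohrRogosinskiSum_le {α : ℝ} (hα : α < 1) {f : ℂ → ℂ}
    (hf : IsStarlikeOfOrder α f) {m N : ℕ} (hm : 1 ≤ m) (hN : 1 ≤ N) {z : ℂ} (hz : ‖z‖ < 1) :
    Summable (fun j : ℕ => ‖taylorCoeff f (N + j)‖ * ‖z‖ ^ (N + j)) ∧
      bohrRogosinskiSum f m N z ≤ starlikeMajorant α m N ‖z‖ := by
  have hle : ∀ j, ‖taylorCoeff f (N + j)‖ * ‖z‖ ^ (N + j) ≤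
      starlikeCoeffBound α (N + j) * ‖z‖ ^ (N + j) := fun j => by
    gcongr
    exact hf.norm_taylorCoeff_le hα (by omega)
  have hs := (hasSum_starlikeCoeffBound_add hα hN (norm_nonneg z) hz).summable
  have hsum := Summable.of_nonneg_of_le (fun j => by positivity) hle hs
  refine ⟨hsum, add_le_add ?_ (hsum.tsum_le_tsum hle hs)⟩
  rw [← norm_pow]
  exact hf.norm_le hα (by rw [norm_pow]; exact pow_lt_one₀ (norm_nonneg z) hz (by omega))

/-- At a nonnegative real point the Koebe coefficients and values are nonnegative, so no modulus
loses anything. -/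
theorem bohrRogosinskiSum_starlikeExtremal {α : ℝ} (hα : α < 1) {m N : ℕ} (hm : 1 ≤ m)
    (hN : 1 ≤ N) {r : ℝ} (h0 : 0 ≤ r) (h1 : r < 1) :
    bohrRogosinskiSum (starlikeExtremal α) m N r = starlikeMajorant α m N r := by
  have hrm : r ^ m < 1 := pow_lt_one₀ h0 h1 (by omega)
  rw [bohrRogosinskiSum, starlikeMajorant, ← Complex.ofReal_pow, starlikeExtremal_ofReal α hrm,
    Complex.norm_real, Complex.norm_real, Real.norm_of_nonneg h0, Real.norm_of_nonneg
      (div_nonneg (pow_nonneg h0 _) (Real.rpow_nonneg (by linarith) _))]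
  congr 2
  funext j
  rw [taylorCoeff_starlikeExtremal (by omega), Complex.norm_real,
    Real.norm_of_nonneg (starlikeCoeffBound_pos hα _).le]

end Majorant

theorem mainTheorem5 (α : ℝ) (hα0 : 0 ≤ α) (hα1 : α < 1) (m N : ℕ) (hm : 1 ≤ m) (hN : 1 ≤ N) :
    ∃ r₀ : ℝ,
      -- `r₀` is the smallest positive root of the equation
      IsLeast {r : ℝ | r ∈ Ioo (0 : ℝ) 1 ∧ radiusEquation α m N r = 0} r₀ ∧
      -- the inequality holds for every function of the class and `|z| ≤ r₀`
      (∀ f : ℂ → ℂ, IsStarlikeOfOrder α f → ∀ z : ℂ, ‖z‖ ≤ r₀ →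
        Summable (fun j : ℕ => ‖taylorCoeff f (N + j)‖ * ‖z‖ ^ (N + j)) ∧
        bohrRogosinskiSum f m N z ≤ distToBoundary f) ∧
      -- sharpness: some function of the class attains equality on `|z| = r₀`
      -- and violates the inequality on every larger circle in the disk
      (∃ f : ℂ → ℂ, IsStarlikeOfOrder α f ∧
        (∃ z : ℂ, ‖z‖ = r₀ ∧ bohrRogosinskiSum f m N z = distToBoundary f) ∧
        (∀ r : ℝ, r₀ < r → r < 1 →
          ∃ z : ℂ, ‖z‖ = r ∧ distToBoundary f < bohrRogosinskiSum f m N z)) := by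
  obtain ⟨r₀, ⟨hr0, hr1⟩, hr⟩ := exists_starlikeMajorant_eq hα1 hm hN
  have hmono := strictMonoOn_starlikeMajorant hα1 hm hN
  have hmem : r₀ ∈ Ico (0 : ℝ) 1 := ⟨hr0.le, hr1⟩
  refine ⟨r₀, ⟨⟨⟨hr0, hr1⟩, ?_⟩, ?_⟩, ?_, starlikeExtremal α,
    isStarlikeOfOrder_starlikeExtremal hα1, ⟨r₀, ?_, ?_⟩, ?_⟩
  · rw [radiusEquation_eq hα1 m hN hr0.le hr1, hr, sub_self]
  · rintro r ⟨⟨h0, h1⟩, h⟩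
    rw [radiusEquation_eq hα1 m hN h0.le h1, sub_eq_zero, ← hr] at h
    exact (hmono.injOn ⟨h0.le, h1⟩ hmem h).ge
  · intro f hf z hz
    obtain ⟨hs, hle⟩ := hf.bohrRogosinskiSum_le hα1 hm hN (hz.trans_lt hr1)
    refine ⟨hs, hle.trans (le_trans ?_ (hf.le_distToBoundary hα0 hα1))⟩
    rw [← hr]
    exact hmono.monotoneOn ⟨norm_nonneg z, hz.trans_lt hr1⟩ hmem hz
  · rw [Complex.norm_real, Real.norm_of_nonneg hr0.le]
  · rw [bohrRogosinskiSum_starlikeExtremal hα1 hm hN hr0.le hr1, hr,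
      distToBoundary_starlikeExtremal hα0 hα1]
  · intro r hr₀r h1
    have h0 : 0 ≤ r := hr0.le.trans hr₀r.le
    refine ⟨r, by rw [Complex.norm_real, Real.norm_of_nonneg h0], ?_⟩
    rw [bohrRogosinskiSum_starlikeExtremal hα1 hm hN h0 h1,
      distToBoundary_starlikeExtremal hα0 hα1, ← hr]
    exact hmono hmem ⟨h0, h1⟩ hr₀r
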